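/- Let $k$ be a field. A \emph{condensed set} is a sheaf of sets on the category of (small) profinite sets, where the covers are the finite jointly surjective families, and an \emph{fpqc sheaf over $k$} is a sheaf of sets on the opposite of the category of (small) commutative $k$-algebras, where the covers are the finite families of flat homomorphisms $A\to B_i$ that are jointly surjective on spectra. Here "small" means: belonging to a fixed universe (equivalently, of cardinality below a fixed strongly inaccessible cardinal), while the sheaves take values in the sets of the next universe. A topological space $V$ defines the condensed set $T\mapsto \mathcal C(T,V)$, and a $k$-scheme defines an fpqc sheaf by its functor of points. Let $X\mapsto X^{\text{pét}}_k$ be the functor from condensed sets to fpqc sheaves over $k$ induced by Stone duality $S\mapsto \mathcal C(S,k)$ (continuous functions on the profinite set $S$ with values in the discrete field $k$), i.e. the left adjoint of the functor sending an fpqc sheaf $\mathcal Y$ to the condensed set $S\mapsto \mathcal Y(\mathcal C(S,k))$. A morphism of condensed sets $U\to X$ is an \emph{open embedding} if for every morphism $S\to X$ from a profinite set $S$, the pullback $U\times_X S\to S$ is the map of condensed sets given by an open embedding of topological spaces. A morphism of fpqc sheaves $\mathcal U\to\mathcal X$ is an \emph{open immersion} if for every $k$-algebra $A$ and every morphism $\operatorname{Spec}(A)\to\mathcal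 X$, the pullback $\mathcal U\times_{\mathcal X}\operatorname{Spec}(A)\to\operatorname{Spec}(A)$ is the map of fpqc sheaves given by an open immersion of $k$-schemes. Let $X$ be a quasi-separated condensed set: for all profinite sets $S$, $T$ over $X$, the condensed set $S\times_X T$ admits a surjection from a profinite set. Then for every open embedding $U\to X$ the induced morphism $U^{\text{pét}}_k\to X^{\text{pét}}_k$ is an open immersion, and $$(U\to X)\longmapsto (U^{\text{pét}}_k\to X^{\text{pét}}_k)$$ is a bijection from the set of isomorphism classes (over $X$) of open embeddings of condensed sets $U\to X$ onto the set of isomorphism classes (over $X^{\text{pét}}_k$) of open immersions of fpqc sheaves $\mathcal U\to X^{\text{pét}}_k$. -/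

import Mathlib

open CategoryTheory Limits Opposite AlgebraicGeometry

universe u

namespace StoneDuality

noncomputable section

/-! ### Condensed sets -/

/-- Condensed sets: sheaves on the site of all (`u`-small) profinite sets with the effective
epimorphism topology, whose covers are the finite jointly surjective families. As for Mathlib's
`CondensedSet`, size is controlled by universes: the universe `u` is the strongly inaccessible
cardinal which bounds the profinite sets. -/
abbrev CondSet := Sheaf (coherentTopology Profinite.{u}) (Type (u + 1))

/-- The functor which sends a topological space `V` to the condensed set `T ↦ C(T, V)`. On
profinite sets it is the Yoneda embedding. -/
def topToCond : TopCat.{u} ⥤ CondSet.{u} :=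
  TopCat.uliftFunctor.{u + 1, u} ⋙ topCatToSheafCompHausLike.{u + 1, u} _
    (fun _ _ _ => ((Profinite.effectiveEpi_tfae _).out 0 2).mp)

/-- A profinite set, viewed as a condensed set. -/
abbrev ofProfinite (S : Profinite.{u}) : CondSet.{u} := topToCond.obj (Profinite.toTopCat.obj S)

/-- A condensed set is quasi-compact if a profinite set surjects onto it. -/
def IsQuasiCompact (Y : CondSet.{u}) : Prop :=
  ∃ (S : Profinite.{u}) (p : ofProfinite S ⟶ Y), Epi p

/-- A condensed set `X` is quasi-separated if `S ×_X T` is quasi-compact for all profinite sets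
`S` and `T` over `X`. -/
def IsQuasiSeparated (X : CondSet.{u}) : Prop :=
  ∀ (S T : Profinite.{u}) (s : ofProfinite S ⟶ X) (t : ofProfinite T ⟶ X),
    IsQuasiCompact (pullback s t)

/-- A map of condensed sets `f : U ⟶ X` is an open embedding if its pullback along every map
`S ⟶ X` from a profinite set is (the map of condensed sets given by) an open embedding of
topological spaces `V ⟶ S`. -/
def IsOpenEmbeddingCond {U X : CondSet.{u}} (f : U ⟶ X) : Prop :=
  ∀ (S : Profinite.{u}) (s : ofProfinite S ⟶ X),
    ∃ (V : TopCat.{u}) (i : V ⟶ Profinite.toTopCat.obj S) (v : topToCond.obj V ⟶ U),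
      Topology.IsOpenEmbedding i ∧ IsPullback v (topToCond.map i) f s

/-! ### fpqc sheaves -/

section

variable (k : Type u) [Field k]

/-- The fpqc coverings of affine `k`-schemes: finite families of flat `k`-algebra homomorphisms
`A ⟶ B i` which are jointly surjective on spectra. -/
def fpqcPrecoverage : Precoverage (CommAlgCat.{u} k)ᵒᵖ where
  coverings X := {R | ∃ (n : ℕ) (B : Fin n → CommAlgCat.{u} k) (φ : ∀ i, X.unop ⟶ B i),
    R = Presieve.ofArrows (fun i => op (B i)) (fun i => (φ i).op) ∧
    (∀ i, (φ i).hom.toRingHom.Flat) ∧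
    ∀ p : PrimeSpectrum X.unop, ∃ i, p ∈ Set.range (PrimeSpectrum.comap (φ i).hom.toRingHom)}

/-- The fpqc topology on affine `k`-schemes. -/
abbrev fpqcTopology : GrothendieckTopology (CommAlgCat.{u} k)ᵒᵖ :=
  (fpqcPrecoverage k).toGrothendieck

/-- fpqc sheaves over `k`, with the same size convention as for condensed sets. -/
abbrev FpqcSheaf := Sheaf (fpqcTopology k) (Type (u + 1))

/-- The functor of points on `k`-algebras of a `k`-scheme. -/
def schemePoints :
    Over (Spec (CommRingCat.of k)) ⥤ ((CommAlgCat.{u} k)ᵒᵖᵒᵖ ⥤ Type (u + 1)) :=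
  uliftYoneda.{u + 1} ⋙ (Functor.whiskeringLeft _ _ _).obj (algSpec (CommRingCat.of k)).op

variable {k}

/-- A map of fpqc sheaves `f : 𝒰 ⟶ 𝒳` is an open immersion if its pullback along every map
`Spec A ⟶ 𝒳`, for `A` a `k`-algebra, is (the map of functors of points given by) an open immersion
of `k`-schemes `W ⟶ Spec A`. -/
def IsOpenImmersionFpqc {𝒰 𝒳 : FpqcSheaf k} (f : 𝒰 ⟶ 𝒳) : Prop :=
  ∀ (A : CommAlgCat.{u} k)
    (x : (schemePoints k).obj ((algSpec (CommRingCat.of k)).obj (op A)) ⟶ 𝒳.obj),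
    ∃ (W : Over (Spec (CommRingCat.of k))) (j : W ⟶ (algSpec (CommRingCat.of k)).obj (op A))
      (w : (schemePoints k).obj W ⟶ 𝒰.obj),
      IsOpenImmersion j.left ∧ IsPullback w ((schemePoints k).map j) f.hom x

/-! ### The pétra space functor -/

variable (k)

/-- The functor `ProFin ⥤ CAlg_kᵒᵖ` of Stone duality, `S ↦ C(S, k)`, for the discrete topology on
`k`: the continuous functions are then the locally constant ones. -/
def stoneFunctor : Profinite.{u} ⥤ (CommAlgCat.{u} k)ᵒᵖ where
  obj S := op (CommAlgCat.of k (LocallyConstant S k))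
  map f := (CommAlgCat.ofHom (LocallyConstant.comapₐ k f.hom.hom)).op

/-- The pétra space functor `f^*`, which sends a condensed set `X` to `X^pét_k`: the functor on
sheaves induced by Stone duality, i.e. the fpqc sheafification of the left Kan extension along
`S ↦ C(S, k)`. It is left adjoint to the functor which sends an fpqc sheaf `𝒳` to the condensed
set `S ↦ 𝒳(C(S, k))`. -/
def petra : CondSet.{u} ⥤ FpqcSheaf k :=
  sheafToPresheaf _ _ ⋙ (stoneFunctor k).op.lan ⋙ presheafToSheaf (fpqcTopology k) (Type (u + 1))

end

/-! ### Open embeddings and open immersions into a fixed object -/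

/-- The open embeddings of condensed sets into `X`. -/
def openEmbeddings (X : CondSet.{u}) : ObjectProperty (Over X) :=
  fun U => IsOpenEmbeddingCond U.hom

/-- The open immersions of fpqc sheaves into `𝒳`. -/
def openImmersions {k : Type u} [Field k] (𝒳 : FpqcSheaf k) : ObjectProperty (Over 𝒳) :=
  fun 𝒰 => IsOpenImmersionFpqc 𝒰.hom

/-- The isomorphism classes of the objects with property `P`. -/
abbrev IsoClasses {C : Type*} [Category* C] (P : ObjectProperty C) :=
  Quotient (isIsomorphicSetoid P.FullSubcategory)

end

end StoneDuality

namespace StoneDuality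

noncomputable section

/-! Open embeddings and open immersions are both classified by maps to a presheaf of open subsets.
Let `Sp` assign a topological space to each object of a site. An open subobject of a sheaf `Q`
amounts to a natural choice, for each section of `Q` over `X`, of an open subset of `Sp X`: the
locus where the section lies in the subobject. Conversely such a choice `c : Q ⟶ opensPresheaf Sp`
recovers the subobject as the sections whose open subset is everything (`Classifies`). So
isomorphism classes of open subobjects are the maps `Q ⟶ opensPresheaf Sp`
(`exists_isoClasses_equiv`); that these are the geometric notions is `isOpenEmbeddingCond_iff` and
`isOpenImmersionFpqc_iff`.

A profinite set `S` is homeomorphic to the spectrum of `C(S, k)` (`stoneHomeo`), so the opens on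
profinite sets are the restriction along Stone duality of the opens on affine schemes. The latter
form an fpqc sheaf (`isSheaf_opensPresheaf`). The universal properties of the left Kan extension and
of sheafification then identify the classifying maps of `X` with those of its pétra space.

It remains to see that this identification is induced by the functor itself.
`Classifies.presheafToSheaf_map` treats sheafification. `Classifies.lan_map` treats the Kan
extension: a map from an affine scheme to a profinite set with image in an open subset factors
through a clopen subset inside it (`refines_clopenImmersions`). -/

/-- The presheaf of open subsets on topological spaces. -/
def opensFunctor : TopCat.{u}ᵒᵖ ⥤ Type (u + 1) where
  obj V := ULift.{u + 1} (TopologicalSpace.Opens V.unop)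
  map f := ↾fun W => ⟨TopologicalSpace.Opens.comap f.unop.hom W.down⟩

/-! ### Subobjects classified by open subsets -/

section Classifies

universe v w

variable {C : Type w} [Category.{v} C] (Sp : C ⥤ TopCat.{u})

/-- The presheaf of open subsets of the underlying spaces of the objects of `C`. -/
def opensPresheaf : Cᵒᵖ ⥤ Type (u + 1) := Sp.op ⋙ opensFunctor

variable {Sp} in
/-- The sections of the presheaf of opens are the open subsets. -/
def toOpens {X : Cᵒᵖ} : (opensPresheaf Sp).obj X ≃ TopologicalSpace.Opens (Sp.obj X.unop) :=
  Equiv.ulift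

variable {Sp} in
lemma coe_toOpens_map {X Y : Cᵒᵖ} (f : X ⟶ Y) (W : (opensPresheaf Sp).obj X) :
    (toOpens ((opensPresheaf Sp).map f W) : Set (Sp.obj Y.unop)) =
      Sp.map f.unop ⁻¹' toOpens W := rfl

variable {Sp} in
lemma toOpens_map_eq_top_iff {X Y : Cᵒᵖ} (f : X ⟶ Y) (W : (opensPresheaf Sp).obj X) :
    toOpens ((opensPresheaf Sp).map f W) = ⊤ ↔
      Set.range (Sp.map f.unop) ⊆ (toOpens W : Set (Sp.obj X.unop)) := by
  rw [← SetLike.coe_set_eq, coe_toOpens_map, TopologicalSpace.Opens.coe_top,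
    Set.preimage_eq_univ_iff]

/-- A map of presheaves `g : P ⟶ Q` is classified by `c : Q ⟶ opensPresheaf Sp` if it is injective
with image the sections on which `c` is the whole space. -/
structure Classifies {P Q : Cᵒᵖ ⥤ Type (u + 1)} (g : P ⟶ Q) (c : Q ⟶ opensPresheaf Sp) :
    Prop where
  injective (X : Cᵒᵖ) : Function.Injective (g.app X)
  mem_range_iff (X : Cᵒᵖ) (x : Q.obj X) : x ∈ Set.range (g.app X) ↔ toOpens (c.app X x) = ⊤

/-- Every point of the underlying space of an object is the image of a map. -/
class EnoughPoints : Prop where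
  exists_range_eq (X : C) (p : Sp.obj X) : ∃ (Y : C) (f : Y ⟶ X), Set.range (Sp.map f) = {p}

variable {Sp} {P P' Q R : Cᵒᵖ ⥤ Type (u + 1)}

namespace Classifies

variable {g : P ⟶ Q} {c : Q ⟶ opensPresheaf Sp}

lemma map_mem_range_iff (h : Classifies Sp g c) {X Y : Cᵒᵖ} (f : X ⟶ Y) (x : Q.obj X) :
    Q.map f x ∈ Set.range (g.app Y) ↔
      Set.range (Sp.map f.unop) ⊆ (toOpens (c.app X x) : Set (Sp.obj X.unop)) := by
  rw [h.mem_range_iff, ← toOpens_map_eq_top_iff, NatTrans.naturality_apply]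

/-- A point `p` lies in the open subset of `x` exactly when the restriction of `x` along a map with
image `{p}` lies in the subobject. -/
lemma unique [EnoughPoints Sp] {c' : Q ⟶ opensPresheaf Sp} (h : Classifies Sp g c)
    (h' : Classifies Sp g c') : c = c' := by
  ext X x
  refine toOpens.injective (TopologicalSpace.Opens.ext (Set.ext fun p => ?_))
  obtain ⟨Y, f, hf⟩ := EnoughPoints.exists_range_eq (Sp := Sp) X.unop p
  have := (h.map_mem_range_iff f.op x).symm.trans (h'.map_mem_range_iff f.op x)
  simpa [hf] using this

/-- Factorization of a map through the subobject that is classified by `c`. -/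
lemma exists_fac (h : Classifies Sp g c) (x : R ⟶ Q)
    (hx : ∀ X (r : R.obj X), toOpens (c.app X (x.app X r)) = ⊤) : ∃ y : R ⟶ P, y ≫ g = x := by
  choose y hy using fun X (r : R.obj X) => (h.mem_range_iff X (x.app X r)).2 (hx X r)
  refine ⟨{ app X := ↾(y X), naturality X Y f := ?_ }, ?_⟩
  · ext r
    apply h.injective
    change g.app Y (y Y (R.map f r)) = g.app Y (P.map f (y X r))
    rw [hy, NatTrans.naturality_apply, NatTrans.naturality_apply, hy]
  · ext X r
    exact hy X r

lemma app_eq_top (h : Classifies Sp g c) (X : Cᵒᵖ) (p : P.obj X) :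
    toOpens (c.app X (g.app X p)) = ⊤ :=
  (h.mem_range_iff X _).1 ⟨p, rfl⟩

lemma mono (h : Classifies Sp g c) : Mono g := by
  have (X : Cᵒᵖ) : Mono (g.app X) := (mono_iff_injective _).2 (h.injective X)
  exact NatTrans.mono_of_mono_app g

lemma exists_iso {g' : P' ⟶ Q} (h : Classifies Sp g c) (h' : Classifies Sp g' c) :
    ∃ e : P ≅ P', e.hom ≫ g' = g := by
  have := h.mono
  have := h'.mono
  obtain ⟨y, hy⟩ := h'.exists_fac g h.app_eq_top
  obtain ⟨z, hz⟩ := h.exists_fac g' h'.app_eq_top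
  exact ⟨⟨y, z, by simp [← cancel_mono g, hy, hz], by simp [← cancel_mono g', hy, hz]⟩, hy⟩

lemma of_iso {g' : P' ⟶ Q} (h : Classifies Sp g c) (e : P' ≅ P) (he : e.hom ≫ g = g') :
    Classifies Sp g' c where
  injective X := by
    have := h.mono
    have : Mono g' := he ▸ mono_comp _ _
    exact (mono_iff_injective _).1 inferInstance
  mem_range_iff X x := by
    rw [← h.mem_range_iff]
    constructor
    · rintro ⟨p, rfl⟩
      exact ⟨e.hom.app X p, by rw [← he]; rfl⟩
    · rintro ⟨p, rfl⟩
      exact ⟨e.inv.app X p, by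
        rw [← he]
        change g.app X ((e.inv ≫ e.hom).app X p) = _
        simp⟩

lemma exists_isPullback {i : R ⟶ P'} {x : P' ⟶ Q} (h : Classifies Sp g c)
    (hi : Classifies Sp i (x ≫ c)) : ∃ y : R ⟶ P, IsPullback y i g x := by
  obtain ⟨y, hy⟩ := h.exists_fac (i ≫ x) hi.app_eq_top
  have := h.mono
  have := hi.mono
  have key (s : PullbackCone g x) : ∃ z : s.pt ⟶ R, z ≫ i = s.snd := by
    refine hi.exists_fac s.snd fun X r => ?_
    change toOpens (c.app X ((s.snd ≫ x).app X r)) = ⊤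
    rw [← s.condition]
    exact h.app_eq_top X _
  choose z hz using key
  refine ⟨y, ⟨hy⟩, ⟨PullbackCone.IsLimit.mk _ z (fun s => ?_) hz
    (fun s m hm hm' => ?_)⟩⟩
  · rw [← cancel_mono g, Category.assoc, hy, reassoc_of% hz, s.condition]
  · rw [← cancel_mono i, hm', hz]

end Classifies

/-- The subpresheaf that is classified by a map to the presheaf of opens. -/
def classified (c : Q ⟶ opensPresheaf Sp) : Subfunctor Q where
  obj X := {x | toOpens (c.app X x) = ⊤}
  map {X Y} f x hx := by
    change toOpens (c.app Y (Q.map f x)) = ⊤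
    rw [NatTrans.naturality_apply, toOpens_map_eq_top_iff]
    rw [Set.mem_ofPred_eq] at hx
    simp [hx]

lemma classified_classifies (c : Q ⟶ opensPresheaf Sp) :
    Classifies Sp (classified c).ι c where
  injective X := Subtype.val_injective
  mem_range_iff X x := ⟨by rintro ⟨x, rfl⟩; exact x.2, fun h => ⟨⟨x, h⟩, rfl⟩⟩

/-- Covers are jointly surjective on points, so an open subset that becomes everything on a cover is
already everything. -/
lemma isSheaf_classified {J : GrothendieckTopology C}
    (hJ : ∀ (X : C) (S : Sieve X), S ∈ J X → ∀ p : Sp.obj X, ∃ (Y : C) (f : Y ⟶ X), S f ∧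
      p ∈ Set.range (Sp.map f))
    (hQ : Presheaf.IsSheaf J Q) (c : Q ⟶ opensPresheaf Sp) :
    Presheaf.IsSheaf J (classified c).toFunctor := by
  rw [isSheaf_iff_isSheaf_of_type] at hQ ⊢
  rw [Subfunctor.isSheaf_iff _ hQ]
  intro X x hx
  refine TopologicalSpace.Opens.ext (Set.eq_univ_of_forall fun p => ?_)
  obtain ⟨Y, f, hf, hp⟩ := hJ _ _ hx p
  change toOpens (c.app _ (Q.map f.op x)) = ⊤ at hf
  rw [NatTrans.naturality_apply, toOpens_map_eq_top_iff] at hf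
  exact hf hp

lemma RepresentableBy.exists_app_eq {X : C} (r : R.RepresentableBy X) (x : Q.obj (op X)) :
    ∃ y : R ⟶ Q, y.app (op X) (r.homEquiv (𝟙 X)) = x := by
  refine ⟨{ app Y := ↾fun y => Q.map (r.homEquiv.symm y : Y.unop ⟶ X).op x,
            naturality Y Z f := ?_ }, ?_⟩
  · ext y
    change Q.map (r.homEquiv.symm (R.map f.unop.op y)).op x =
      Q.map f (Q.map (r.homEquiv.symm y : Y.unop ⟶ X).op x)
    rw [← r.comp_homEquiv_symm, op_comp, Functor.map_comp_apply]
    rfl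
  · change Q.map (r.homEquiv.symm (r.homEquiv (𝟙 X)) : X ⟶ X).op x = x
    rw [Equiv.symm_apply_apply]
    simp

/-- Each section of `Q` gets its open subset from the pullback along the corresponding map out of a
representable presheaf. These choices are independent of each other; they fit together because each
is determined by which restrictions of the section lie in the image of `g`. -/
lemma exists_classifies_of_locally [EnoughPoints Sp] (g : P ⟶ Q)
    (hg : ∀ (X : C) (x : Q.obj (op X)), ∃ (R R' : Cᵒᵖ ⥤ Type (u + 1)) (r : R'.RepresentableBy X)
      (q : R' ⟶ Q) (i : R ⟶ R') (v : R ⟶ P) (c : R' ⟶ opensPresheaf Sp),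
      q.app _ (r.homEquiv (𝟙 X)) = x ∧ IsPullback v i g q ∧ Classifies Sp i c) :
    ∃ c : Q ⟶ opensPresheaf Sp, Classifies Sp g c := by
  have hinj (X : Cᵒᵖ) : Function.Injective (g.app X) := by
    intro p p' hp
    obtain ⟨R, R', r, q, i, v, c, hx, sq, hi⟩ := hg X.unop (g.app X p)
    have sq' := sq.map ((evaluation Cᵒᵖ (Type (u + 1))).obj X)
    obtain ⟨z, rfl, hz⟩ := Types.exists_of_isPullback sq' p (r.homEquiv (𝟙 _)) hx.symm
    obtain ⟨z', rfl, hz'⟩ := Types.exists_of_isPullback sq' p' (r.homEquiv (𝟙 _))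
      (hp.symm.trans hx.symm)
    exact congrArg _ (hi.injective X (hz.trans hz'.symm))
  -- Quantifying over all `f` characterizes `W` without reference to the local data, which is what
  -- naturality needs.
  have hW (X : Cᵒᵖ) (x : Q.obj X) : ∃ W : TopologicalSpace.Opens (Sp.obj X.unop),
      ∀ (Y : C) (f : Y ⟶ X.unop), Q.map f.op x ∈ Set.range (g.app (op Y)) ↔
        Set.range (Sp.map f) ⊆ (W : Set (Sp.obj X.unop)) := by
    obtain ⟨R, R', r, q, i, v, c, hx, sq, hi⟩ := hg X.unop x
    refine ⟨toOpens (c.app X (r.homEquiv (𝟙 _))), fun Y f => ?_⟩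
    rw [← f.unop_op, ← hi.map_mem_range_iff f.op]
    have hq : Q.map f.op x = q.app _ (R'.map f.op (r.homEquiv (𝟙 _))) := by
      rw [NatTrans.naturality_apply]
      exact congrArg _ hx.symm
    rw [f.unop_op, hq]
    constructor
    · rintro ⟨p, hp⟩
      obtain ⟨z, -, hz⟩ := Types.exists_of_isPullback
        (sq.map ((evaluation Cᵒᵖ (Type (u + 1))).obj (op Y))) p _ hp
      exact ⟨z, hz⟩
    · rintro ⟨z, hz⟩
      refine ⟨v.app _ z, ?_⟩
      rw [← hz]
      exact ConcreteCategory.congr_hom (NatTrans.congr_app sq.w (op Y)) z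
  choose W hW using hW
  refine ⟨{ app X := ↾fun x => toOpens.symm (W X x), naturality X Y f := ?_ },
    ⟨hinj, fun X x => ?_⟩⟩
  · ext x
    refine toOpens.injective (TopologicalSpace.Opens.ext (Set.ext fun p => ?_))
    obtain ⟨Z, h, hh⟩ := EnoughPoints.exists_range_eq (Sp := Sp) Y.unop p
    have h1 := hW Y (Q.map f x) Z h
    have h2 := hW X x Z (h ≫ f.unop)
    rw [op_comp, Functor.map_comp_apply] at h2
    replace h1 := h1.symm.trans h2
    rw [Functor.map_comp, TopCat.coe_comp, Set.range_comp, hh, Set.image_singleton,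
      Set.singleton_subset_iff, Set.singleton_subset_iff] at h1
    exact h1
  · have := hW X x _ (𝟙 _)
    rw [op_id, Functor.map_id_apply] at this
    refine this.trans ?_
    rw [CategoryTheory.Functor.map_id, TopCat.coe_id, Set.range_id, Set.univ_subset_iff]
    exact SetLike.coe_set_eq (q := ⊤)

end Classifies

/-! ### Isomorphism classes as classifying maps -/

section IsoClasses

universe v w

variable {C : Type w} [Category.{v} C] {Sp : C ⥤ TopCat.{u}}

lemma exists_isoClasses_equiv [EnoughPoints Sp] {J : GrothendieckTopology C}
    (hJ : ∀ (X : C) (S : Sieve X), S ∈ J X → ∀ p : Sp.obj X, ∃ (Y : C) (f : Y ⟶ X), S f ∧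
      p ∈ Set.range (Sp.map f))
    (X : Sheaf J (Type (u + 1))) (P : ObjectProperty (Over X))
    (hP : ∀ U : Over X, P U ↔ ∃ c : X.obj ⟶ opensPresheaf Sp, Classifies Sp U.hom.hom c) :
    ∃ e : IsoClasses P ≃ (X.obj ⟶ opensPresheaf Sp),
      ∀ U : P.FullSubcategory, Classifies Sp U.obj.hom.hom (e (Quotient.mk _ U)) := by
  choose c hc using fun U : P.FullSubcategory => (hP U.obj).1 U.property
  let φ : IsoClasses P → (X.obj ⟶ opensPresheaf Sp) := Quotient.lift c <| by
    rintro U V ⟨e⟩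
    refine (hc U).unique ((hc V).of_iso ((sheafToPresheaf _ _).mapIso
      ((Over.forget X).mapIso (P.ι.mapIso e))) ?_)
    exact congrArg (fun f => f.hom) (Over.w (P.ι.map e.hom))
  refine ⟨Equiv.ofBijective φ ⟨?_, ?_⟩, hc⟩
  · rintro ⟨U⟩ ⟨V⟩ (h : c U = c V)
    obtain ⟨e, he⟩ := (hc U).exists_iso (h ▸ hc V)
    refine Quotient.sound ⟨P.fullyFaithfulι.preimageIso
      (Over.isoMk ((fullyFaithfulSheafToPresheaf _ _).preimageIso e) ?_)⟩
    exact Sheaf.hom_ext he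
  · intro d
    let K : Sheaf J (Type (u + 1)) := ⟨_, isSheaf_classified hJ X.property d⟩
    let U : Over X := Over.mk (Y := K) ⟨(classified d).ι⟩
    have hU : Classifies Sp U.hom.hom d := classified_classifies d
    exact ⟨Quotient.mk _ ⟨U, (hP U).2 ⟨d, hU⟩⟩, (hc ⟨U, _⟩).unique hU⟩

end IsoClasses

/-! ### Sheafification of classified subobjects -/

section Sheafification

universe v w

variable {C : Type w} [Category.{v} C] {Sp : C ⥤ TopCat.{u}} {J : GrothendieckTopology C}
  [HasSheafify J (Type (u + 1))] [J.WEqualsLocallyBijective (Type (u + 1))]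

variable (J) in
lemma Classifies.presheafToSheaf_map
    (hJ : ∀ (X : C) (S : Sieve X), S ∈ J X → ∀ p : Sp.obj X, ∃ (Y : C) (f : Y ⟶ X), S f ∧
      p ∈ Set.range (Sp.map f)) {P Q : Cᵒᵖ ⥤ Type (u + 1)} {g : P ⟶ Q}
    {c : sheafify J Q ⟶ opensPresheaf Sp}
    (h : Classifies Sp g (toSheafify J Q ≫ c)) :
    Classifies Sp ((presheafToSheaf J (Type (u + 1))).map g).hom c := by
  have : Mono g := h.mono
  have hm : Mono (sheafifyMap J g) :=
    inferInstanceAs (Mono ((sheafToPresheaf J _).map ((presheafToSheaf J (Type (u + 1))).map g)))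
  have hinj (X : Cᵒᵖ) : Function.Injective ((sheafifyMap J g).app X) :=
    (mono_iff_injective _).1 inferInstance
  have hη (X : Cᵒᵖ) (p : P.obj X) : (sheafifyMap J g).app X ((toSheafify J P).app X p) =
      (toSheafify J Q).app X (g.app X p) :=
    ConcreteCategory.congr_hom (NatTrans.congr_app (toSheafify_naturality J g).symm X) p
  refine ⟨hinj, fun X x => ⟨?_, fun hx => ?_⟩⟩
  · rintro ⟨y, rfl⟩
    change toOpens (c.app X ((sheafifyMap J g).app X y)) = ⊤
    -- Locally `y` comes from the presheaf `P`, where the open subset is everything; the cover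
    -- reaches every point.
    have hs := Presheaf.imageSieve_mem J (toSheafify J P) y
    refine TopologicalSpace.Opens.ext (Set.eq_univ_of_forall fun p => ?_)
    obtain ⟨Y, f, ⟨z, hz⟩, hp⟩ := hJ _ _ hs p
    have := h.app_eq_top _ z
    change toOpens (c.app _ ((toSheafify J Q).app _ (g.app _ z))) = ⊤ at this
    rw [← hη, hz, NatTrans.naturality_apply, NatTrans.naturality_apply,
      toOpens_map_eq_top_iff] at this
    exact this hp
  -- The image is isomorphic to the sheafification of `P`, so membership in it is local, and locally
  -- `x` comes from the presheaf `Q`.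
  · have hR : Presieve.IsSheaf J (Subfunctor.range (sheafifyMap J g)).toFunctor := by
      have : Mono (Subfunctor.toRange (sheafifyMap J g)) :=
        mono_of_mono_fac (Subfunctor.toRange_ι _)
      have : IsIso (Subfunctor.toRange (sheafifyMap J g)) := isIso_of_mono_of_epi _
      exact Presieve.isSheaf_iso J (asIso (Subfunctor.toRange (sheafifyMap J g)))
        ((isSheaf_iff_isSheaf_of_type _ _).1 ((presheafToSheaf J _).obj P).property)
    rw [Subfunctor.isSheaf_iff _
      ((isSheaf_iff_isSheaf_of_type _ _).1 ((presheafToSheaf J _).obj Q).property)] at hR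
    refine hR X x (J.superset_covering ?_ (Presheaf.imageSieve_mem J (toSheafify J Q) x))
    rintro Y f ⟨q, hq⟩
    have : toOpens ((toSheafify J Q ≫ c).app _ q) = ⊤ := by
      change toOpens (c.app _ ((toSheafify J Q).app _ q)) = ⊤
      rw [hq, NatTrans.naturality_apply, toOpens_map_eq_top_iff, hx]
      exact Set.subset_univ _
    obtain ⟨p, hp⟩ := (h.mem_range_iff _ q).2 this
    refine ⟨(toSheafify J P).app _ p, ?_⟩
    rw [hη, hp, hq]

end Sheafification

/-! ### Left Kan extension of classified subobjects -/

section Lan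

universe v v' w w'

variable {C : Type w} [Category.{v} C] {D : Type w'} [Category.{v'} D]
  (F : C ⥤ D)
  [∀ P : Cᵒᵖ ⥤ Type (u + 1), F.op.HasPointwiseLeftKanExtension P]
  {P Q : Cᵒᵖ ⥤ Type (u + 1)}

/-- The section of the left Kan extension defined by a section over `S` and a map `Y ⟶ F.obj S`. -/
def lanMk (P : Cᵒᵖ ⥤ Type (u + 1)) {S : C} {Y : D} (φ : Y ⟶ F.obj S) (x : P.obj (op S)) :
    (F.op.lan.obj P).obj (op Y) :=
  (F.op.lan.obj P).map φ.op ((F.op.lanUnit.app P).app (op S) x)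

variable {F}

lemma lanMk_comp {S T : C} {Y : D} (φ : Y ⟶ F.obj T) (f : T ⟶ S) (x : P.obj (op S)) :
    lanMk F P (φ ≫ F.map f) x = lanMk F P φ (P.map f.op x) := by
  have := ConcreteCategory.congr_hom ((F.op.lanUnit.app P).naturality f.op) x
  unfold lanMk
  rw [op_comp, Functor.map_comp_apply]
  exact congrArg _ this.symm

lemma lan_map_lanMk (g : P ⟶ Q) {S : C} {Y : D} (φ : Y ⟶ F.obj S) (x : P.obj (op S)) :
    (F.op.lan.map g).app (op Y) (lanMk F P φ x) = lanMk F Q φ (g.app _ x) := by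
  have := ConcreteCategory.congr_hom (NatTrans.congr_app (F.op.lanUnit.naturality g) (op S)) x
  unfold lanMk
  rw [NatTrans.naturality_apply]
  exact congrArg _ this.symm

/-- The cocone of the sections `lanMk F P φ x` is a colimit. -/
def isColimitLan (P : Cᵒᵖ ⥤ Type (u + 1)) (Y : D) :=
  F.op.isPointwiseLeftKanExtensionLeftKanExtensionUnit P (op Y)

lemma exists_lanMk_eq {Y : D} (z : (F.op.lan.obj P).obj (op Y)) :
    ∃ (S : C) (φ : Y ⟶ F.obj S) (x : P.obj (op S)), lanMk F P φ x = z := by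
  obtain ⟨j, x, hx⟩ := Types.jointly_surjective_of_isColimit (isColimitLan (F := F) P Y) z
  exact ⟨j.left.unop, j.hom.unop, x, hx⟩

lemma exists_lan_desc {Y : D} {T : Type (u + 1)}
    (r : ∀ (S : C), (Y ⟶ F.obj S) → P.obj (op S) → T)
    (hr : ∀ (S S' : C) (f : S' ⟶ S) (φ : Y ⟶ F.obj S') (x : P.obj (op S)),
      r S (φ ≫ F.map f) x = r S' φ (P.map f.op x)) :
    ∃ d : (F.op.lan.obj P).obj (op Y) → T,
      ∀ (S : C) (φ : Y ⟶ F.obj S) (x : P.obj (op S)), d (lanMk F P φ x) = r S φ x := by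
  let s : Cocone (CostructuredArrow.proj F.op (op Y) ⋙ P) :=
    { pt := T
      ι := { app := fun j => ↾fun x => r j.left.unop j.hom.unop x
             naturality := fun i j f => by
              ext x
              have := hr i.left.unop j.left.unop f.left.unop j.hom.unop x
              have w : i.hom.unop = j.hom.unop ≫ F.map f.left.unop := by
                rw [← CostructuredArrow.w f]; rfl
              rw [← w] at this
              exact this.symm } }
  refine ⟨(isColimitLan (F := F) P Y).desc s, fun S φ x => ?_⟩
  exact ConcreteCategory.congr_hom
    ((isColimitLan (F := F) P Y).fac s (CostructuredArrow.mk (Y := op S) φ.op)) x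

/-- The open subset of the underlying space of `F.obj S` which a section over `S` determines. -/
def opensAt {Sp : D ⥤ TopCat.{u}} (c : Q ⟶ opensPresheaf (F ⋙ Sp)) {S : C} (x : Q.obj (op S)) :
    TopologicalSpace.Opens (Sp.obj (F.obj S)) := toOpens (c.app _ x)

/-- A class `M` of maps in `C` through which maps `Y ⟶ F.obj S` with image in a given open subset
factor, in an essentially unique way. -/
structure Refines (F : C ⥤ D) (Sp : D ⥤ TopCat.{u}) (M : MorphismProperty C) : Prop where
  exists_fac {Y : D} {S : C} (φ : Y ⟶ F.obj S) (W : TopologicalSpace.Opens (Sp.obj (F.obj S)))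
    (h : Set.range (Sp.map φ) ⊆ (W : Set (Sp.obj (F.obj S)))) :
    ∃ (K : C) (m : K ⟶ S) (ψ : Y ⟶ F.obj K), M m ∧
      Set.range (Sp.map (F.map m)) ⊆ (W : Set (Sp.obj (F.obj S))) ∧ ψ ≫ F.map m = φ
  exists_lift {Y : D} {S K T : C} (m : K ⟶ S) (n : T ⟶ S) (hm : M m) (ψ : Y ⟶ F.obj K)
    (φ : Y ⟶ F.obj T) (h : ψ ≫ F.map m = φ ≫ F.map n) :
    ∃ (L : C) (p : L ⟶ K) (q : L ⟶ T) (χ : Y ⟶ F.obj L), p ≫ m = q ≫ n ∧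
      χ ≫ F.map p = ψ ∧ χ ≫ F.map q = φ

/-- Over the common refinement `L` from `exists_lift`, `a` and `b` have the same image in `Q`, hence
agree by injectivity of `g`. -/
lemma lanMk_eq_lanMk {Sp : D ⥤ TopCat.{u}} {M : MorphismProperty C} (hM : Refines F Sp M)
    {g : P ⟶ Q} (hg : ∀ X, Function.Injective (g.app X)) {Y : D} {S K T : C} (m : K ⟶ S)
    (n : T ⟶ S) (hm : M m) (ψ : Y ⟶ F.obj K) (φ : Y ⟶ F.obj T)
    (h : ψ ≫ F.map m = φ ≫ F.map n) (x : Q.obj (op S)) (a : P.obj (op K)) (b : P.obj (op T))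
    (ha : g.app _ a = Q.map m.op x) (hb : g.app _ b = Q.map n.op x) :
    lanMk F P ψ a = lanMk F P φ b := by
  obtain ⟨L, p, q, χ, hpq, rfl, rfl⟩ := hM.exists_lift m n hm ψ φ h
  rw [lanMk_comp, lanMk_comp]
  congr 1
  apply hg
  rw [NatTrans.naturality_apply, NatTrans.naturality_apply, ha, hb, ← Functor.map_comp_apply,
    ← Functor.map_comp_apply, ← op_comp, ← op_comp, hpq]

theorem Classifies.lan_map {Sp : D ⥤ TopCat.{u}} {M : MorphismProperty C} (hM : Refines F Sp M)
    {g : P ⟶ Q} {c : Q ⟶ opensPresheaf (F ⋙ Sp)} (h : Classifies (F ⋙ Sp) g c)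
    {c' : F.op.lan.obj Q ⟶ opensPresheaf Sp}
    (hc : ∀ (S : C) (Y : D) (φ : Y ⟶ F.obj S) (x : Q.obj (op S)),
      (toOpens (c'.app _ (lanMk F Q φ x)) : Set (Sp.obj Y)) = Sp.map φ ⁻¹' opensAt c x) :
    Classifies Sp (F.op.lan.map g) c' := by
  have hc' {S : C} {Y : D} (φ : Y ⟶ F.obj S) (x : Q.obj (op S)) :
      toOpens (c'.app _ (lanMk F Q φ x)) = ⊤ ↔
        Set.range (Sp.map φ) ⊆ (opensAt c x : Set (Sp.obj (F.obj S))) := by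
    rw [← SetLike.coe_set_eq, hc, TopologicalSpace.Opens.coe_top, Set.preimage_eq_univ_iff]
  have key {S : C} {Y : D} (φ : Y ⟶ F.obj S) (x : Q.obj (op S))
      (hx : toOpens (c'.app _ (lanMk F Q φ x)) = ⊤) :
      ∃ (K : C) (m : K ⟶ S) (ψ : Y ⟶ F.obj K) (a : P.obj (op K)), M m ∧ ψ ≫ F.map m = φ ∧
        g.app _ a = Q.map m.op x := by
    obtain ⟨K, m, ψ, hm, hK, rfl⟩ := hM.exists_fac φ _ ((hc' φ x).1 hx)
    obtain ⟨a, ha⟩ := (h.map_mem_range_iff m.op x).2 hK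
    exact ⟨K, m, ψ, a, hm, rfl, ha⟩
  have htop {S : C} {Y : D} (φ : Y ⟶ F.obj S) (a : P.obj (op S)) :
      toOpens (c'.app _ (lanMk F Q φ (g.app _ a))) = ⊤ := by
    rw [hc', show opensAt c (g.app _ a) = ⊤ from h.app_eq_top _ a]
    exact Set.subset_univ _
  refine ⟨fun Y => ?_, fun Y z => ⟨?_, fun hz => ?_⟩⟩
  -- Injectivity comes from a partial retraction: where the open subset is everything, factor
  -- through `M` and lift to `P`; elsewhere the value is `none`. `Option` makes it total, so it can
  -- be defined by the colimit property.
  · obtain ⟨d, hd⟩ : ∃ d : (F.op.lan.obj Q).obj Y → Option ((F.op.lan.obj P).obj Y),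
        ∀ w, d ((F.op.lan.map g).app Y w) = some w := by
      classical
      choose K m ψ a hm hψ ha using @key
      let r (S : C) (φ : Y.unop ⟶ F.obj S) (x : Q.obj (op S)) :
          Option ((F.op.lan.obj P).obj Y) :=
        if hx : toOpens (c'.app _ (lanMk F Q φ x)) = ⊤ then
          some (lanMk F P (ψ φ x hx) (a φ x hx)) else none
      obtain ⟨d, hd⟩ := exists_lan_desc (Y := Y.unop) r <| by
        intro S S' f φ x
        dsimp only [r]
        by_cases hx : toOpens (c'.app _ (lanMk F Q (φ ≫ F.map f) x)) = ⊤
        · have hx' := hx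
          rw [lanMk_comp] at hx'
          rw [dif_pos hx, dif_pos hx']
          congr 1
          refine lanMk_eq_lanMk hM h.injective (m _ _ hx) (m _ _ hx' ≫ f) (hm _ _ hx) _ _ ?_ x _ _
            (ha _ _ hx) ?_
          · rw [hψ, Functor.map_comp, reassoc_of% hψ]
          · rw [ha, op_comp, Functor.map_comp_apply]
        · have hx' := hx
          rw [lanMk_comp] at hx'
          rw [dif_neg hx, dif_neg hx']
      refine ⟨d, fun w => ?_⟩
      obtain ⟨S, φ, b, rfl⟩ := exists_lanMk_eq (Y := Y.unop) w
      refine (congrArg d (lan_map_lanMk g φ b)).trans ((hd S φ _).trans ?_)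
      dsimp only [r]
      rw [dif_pos (htop φ b)]
      congr 1
      refine lanMk_eq_lanMk hM h.injective (m _ _ (htop φ b)) (𝟙 S) (hm _ _ _) _ _ ?_
        (g.app _ b) _ _
        (ha _ _ _) ?_
      · rw [hψ, CategoryTheory.Functor.map_id, Category.comp_id]
      · rw [op_id, Functor.map_id_apply]
    intro w w' hw
    exact Option.some_injective _ ((hd w).symm.trans ((congrArg d hw).trans (hd w')))
  · rintro ⟨w, rfl⟩
    obtain ⟨S, φ, b, rfl⟩ := exists_lanMk_eq (Y := Y.unop) w
    rw [← htop φ b]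
    exact congrArg (fun z => toOpens (c'.app _ z)) (lan_map_lanMk g φ b)
  · obtain ⟨S, φ, x, rfl⟩ := exists_lanMk_eq (Y := Y.unop) z
    obtain ⟨K, m, ψ, a, hm, rfl, ha⟩ := key φ x hz
    refine ⟨lanMk F P ψ a, (lan_map_lanMk g ψ a).trans ?_⟩
    rw [ha, ← lanMk_comp]

/-- By definition `opensPresheaf (F ⋙ Sp)` is the restriction of `opensPresheaf Sp` along `F`, so
this is the universal property of the Kan extension. -/
lemma exists_lan_equiv (Q : Cᵒᵖ ⥤ Type (u + 1)) (Sp : D ⥤ TopCat.{u}) :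
    ∃ e : (Q ⟶ opensPresheaf (F ⋙ Sp)) ≃ (F.op.lan.obj Q ⟶ opensPresheaf Sp),
      ∀ c (S : C) (Y : D) (φ : Y ⟶ F.obj S) (x : Q.obj (op S)),
        (toOpens ((e c).app _ (lanMk F Q φ x)) : Set (Sp.obj Y)) =
          Sp.map φ ⁻¹' opensAt c x := by
  let e : (F.op.lan.obj Q ⟶ opensPresheaf Sp) ≃ (Q ⟶ opensPresheaf (F ⋙ Sp)) :=
    Functor.homEquivOfIsLeftKanExtension _ (F.op.lanUnit.app Q) (opensPresheaf Sp)
  refine ⟨e.symm, fun c S Y φ x => ?_⟩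
  obtain ⟨c, rfl⟩ := e.surjective c
  rw [Equiv.symm_apply_apply]
  have : (e c).app _ x = c.app _ ((F.op.lanUnit.app Q).app _ x) := rfl
  rw [opensAt, this]
  unfold lanMk
  rw [NatTrans.naturality_apply]
  rfl

end Lan

/-! ### Open subsets of affine schemes and fpqc descent -/

/-- A subset of an affine scheme is open if its preimages under a finite jointly surjective family
of flat morphisms from affine schemes are. -/
lemma isOpen_of_flat {ι : Type u} [Finite ι] {X : Scheme.{u}} {Y : ι → Scheme.{u}}
    [IsAffine X] [∀ i, IsAffine (Y i)] (f : ∀ i, Y i ⟶ X) [∀ i, Flat (f i)]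
    (hs : ∀ p : X, ∃ i, p ∈ Set.range (f i)) (V : Set X) (hV : ∀ i, IsOpen (f i ⁻¹' V)) :
    IsOpen V := by
  have : Surjective (Sigma.desc f) :=
    Surjective.sigmaDesc_of_union_range_eq_univ
      (Set.eq_univ_of_forall fun p => Set.mem_iUnion.2 (hs p))
  -- A finite coproduct of affine schemes is affine, so `Sigma.desc f` is quasi-compact; being also
  -- flat and surjective, it is a topological quotient map.
  refine (Flat.isQuotientMap_of_surjective (Sigma.desc f)).isOpen_preimage.1 ?_
  refine (sigmaMk Y).isOpen_preimage.1 (isOpen_sigma_iff.2 fun i => ?_)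
  convert hV i using 1
  ext x
  simp only [Set.mem_preimage, sigmaMk_mk]
  rw [← Scheme.Hom.comp_apply, Sigma.ι_desc]

section Fpqc

variable (k : Type u) [Field k]

/-- The underlying scheme of the spectrum of a `k`-algebra. -/
def specScheme : (CommAlgCat.{u} k)ᵒᵖ ⥤ Scheme.{u} :=
  algSpec (CommRingCat.of k) ⋙ Over.forget _

/-- The underlying topological space of the spectrum of a `k`-algebra. -/
def specTop : (CommAlgCat.{u} k)ᵒᵖ ⥤ TopCat.{u} := specScheme k ⋙ Scheme.forgetToTop

variable {k}

instance : PreservesLimitsOfShape WalkingCospan (specScheme k) := by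
  have := (preservesLimitsOfSize_algSpec.{0, 0} (R := CommRingCat.of k)).preservesLimitsOfShape
    (J := WalkingCospan)
  have : PreservesLimitsOfShape WalkingCospan (Over.forget (Spec (CommRingCat.of k))) :=
    inferInstance
  exact comp_preservesLimitsOfShape _ _

instance : EnoughPoints (specTop k) where
  exists_range_eq A p :=
    let p' : PrimeSpectrum A.unop := p
    ⟨op (CommAlgCat.of k p'.asIdeal.ResidueField),
      (CommAlgCat.ofHom (IsScalarTower.toAlgHom k A.unop p'.asIdeal.ResidueField)).op,
      p'.residueField_comap⟩

lemma specScheme_exists_lift {A B C : (CommAlgCat.{u} k)ᵒᵖ} (f : A ⟶ C) (g : B ⟶ C)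
    (p : (specTop k).obj A) (q : (specTop k).obj B)
    (h : (specTop k).map f p = (specTop k).map g q) :
    ∃ (D : (CommAlgCat.{u} k)ᵒᵖ) (a : D ⟶ A) (b : D ⟶ B) (r : (specTop k).obj D),
      a ≫ f = b ≫ g ∧ (specTop k).map a r = p ∧ (specTop k).map b r = q := by
  have sq := (IsPullback.of_hasPullback f g).map (specScheme k)
  obtain ⟨z, hz, hz'⟩ := Scheme.Pullback.exists_preimage_pullback
    (f := (specScheme k).map f) (g := (specScheme k).map g) p q h
  refine ⟨pullback f g, pullback.fst f g, pullback.snd f g, sq.isoPullback.inv z,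
    pullback.condition, ?_, ?_⟩
  · rw [← hz]
    exact congr($(sq.isoPullback_inv_fst) z)
  · rw [← hz']
    exact congr($(sq.isoPullback_inv_snd) z)

/-- Joint surjectivity survives each step generating the topology; for base change, points with the
same image lift to the fibre product. -/
lemma exists_mem_range_of_mem_fpqcTopology (X : (CommAlgCat.{u} k)ᵒᵖ) (S : Sieve X)
    (hS : S ∈ fpqcTopology k X) (p : (specTop k).obj X) :
    ∃ (Y : (CommAlgCat.{u} k)ᵒᵖ) (f : Y ⟶ X), S f ∧ p ∈ Set.range ((specTop k).map f) := by
  replace hS : (fpqcPrecoverage k).Saturate X S := hS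
  induction hS with
  | of X R hR =>
    obtain ⟨n, B, φ, rfl, -, h⟩ := hR
    obtain ⟨i, hi⟩ := h p
    exact ⟨op (B i), (φ i).op, ⟨_, 𝟙 _, _, Presieve.ofArrows.mk i, Category.id_comp _⟩, hi⟩
  | top X =>
    exact ⟨X, 𝟙 X, trivial, p, by simp⟩
  | pullback X S _ Y f ih =>
    obtain ⟨Z, g, hg, q, hq⟩ := ih ((specTop k).map f p)
    obtain ⟨W, a, b, r, hab, hr, -⟩ := specScheme_exists_lift f g p q hq.symm
    refine ⟨W, a, ?_, r, hr⟩
    change S (a ≫ f)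
    rw [hab]
    exact S.downward_closed hg b
  | transitive X S R _ _ ih ih' =>
    obtain ⟨Y, f, hf, q, rfl⟩ := ih p
    obtain ⟨Z, g, hg, r, rfl⟩ := ih' hf q
    exact ⟨Z, g ≫ f, hg, r, by simp⟩

lemma isSheafFor_opensPresheaf {n : ℕ} {X : (CommAlgCat.{u} k)ᵒᵖ}
    {B : Fin n → (CommAlgCat.{u} k)ᵒᵖ} (φ : ∀ i, B i ⟶ X) [∀ i, Flat ((specScheme k).map (φ i))]
    (hs : ∀ p : (specTop k).obj X, ∃ i, p ∈ Set.range ((specTop k).map (φ i))) :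
    (Presieve.ofArrows B φ).IsSheafFor (opensPresheaf (specTop k)) := by
  rw [Presieve.isSheafFor_arrows_iff]
  intro W hW
  let f (i : Fin n) := (specTop k).map (φ i)
  -- The glued open is the union of the images. Compatibility on fibre products gives back each `W
  -- i` as its preimage, and then flat descent makes it open.
  let V : Set ((specTop k).obj X) := {p | ∃ i q, f i q = p ∧ q ∈ toOpens (W i)}
  have hV (i : Fin n) : f i ⁻¹' V = toOpens (W i) := by
    ext q
    refine ⟨?_, fun hq => ⟨i, q, rfl, hq⟩⟩
    rintro ⟨j, q', hq', hmem⟩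
    obtain ⟨D, a, b, r, hab, rfl, rfl⟩ := specScheme_exists_lift _ _ q' q hq'
    have := congrArg toOpens (hW _ _ _ _ _ hab)
    exact (SetLike.ext_iff.1 this r).1 hmem
  have hVo : IsOpen V := by
    have (i : Fin n) : IsAffine ((specScheme k).obj (B i)) := inferInstanceAs (IsAffine (Spec _))
    have : IsAffine ((specScheme k).obj X) := inferInstanceAs (IsAffine (Spec _))
    refine isOpen_of_flat (fun i : ULift.{u} (Fin n) => (specScheme k).map (φ i.down))
      (fun p => ?_) V fun ⟨i⟩ => ?_
    · obtain ⟨i, hi⟩ := hs p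
      exact ⟨⟨i⟩, hi⟩
    have := (toOpens (W i)).isOpen
    rw [← hV] at this
    exact this
  refine ⟨toOpens.symm ⟨V, hVo⟩, fun i => ?_, fun W' hW' => ?_⟩
  · exact toOpens.injective (TopologicalSpace.Opens.ext (hV i))
  · refine toOpens.injective (TopologicalSpace.Opens.ext (Set.ext fun p => ?_))
    obtain ⟨i, q, rfl⟩ := hs p
    have h := congrArg toOpens (hW' i)
    exact (SetLike.ext_iff.1 h q).trans (Set.ext_iff.1 (hV i) q).symm

lemma isSheaf_opensPresheaf : Presheaf.IsSheaf (fpqcTopology k) (opensPresheaf (specTop k)) := by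
  rw [isSheaf_iff_isSheaf_of_type, Precoverage.isSheaf_toGrothendieck_iff]
  rintro X Y g _ ⟨n, B, φ, rfl, hφ, hs⟩
  rw [← Sieve.pullbackArrows_comm, ← Presieve.isSheafFor_iff_generate, ← Presieve.ofArrows_pullback]
  have (i : Fin n) : Flat ((specScheme k).map (pullback.snd (φ i).op g)) := by
    have : Flat ((specScheme k).map (φ i).op) := Flat.SpecMap_iff.2 (hφ i)
    exact MorphismProperty.of_isPullback (P := @Flat)
      ((IsPullback.of_hasPullback (φ i).op g).map (specScheme k)) this
  refine isSheafFor_opensPresheaf _ fun p => ?_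
  obtain ⟨i, q, hq⟩ := hs ((specTop k).map g p)
  obtain ⟨D, a, b, r, hab, -, hr⟩ := specScheme_exists_lift (φ i).op g q p hq
  refine ⟨i, (specTop k).map (pullback.lift a b hab) r, ?_⟩
  rw [← ConcreteCategory.comp_apply, ← Functor.map_comp, pullback.lift_snd, hr]

/-- The functor of points of the spectrum of a `k`-algebra is representable. -/
def schemePointsRepresentableBy (A : (CommAlgCat.{u} k)ᵒᵖ) :
    ((schemePoints k).obj ((algSpec (CommRingCat.of k)).obj A)).RepresentableBy A where
  homEquiv := (algSpec.fullyFaithful (R := CommRingCat.of k)).homEquiv.trans Equiv.ulift.symm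
  homEquiv_comp f g := congrArg ULift.up ((algSpec (CommRingCat.of k)).map_comp f g)

/-- A morphism of schemes factors through an open immersion as soon as it does so on points. -/
lemma classifies_schemePoints_map {A : (CommAlgCat.{u} k)ᵒᵖ} {W : Over (Spec (CommRingCat.of k))}
    (j : W ⟶ (algSpec (CommRingCat.of k)).obj A) [IsOpenImmersion j.left]
    (c : (schemePoints k).obj ((algSpec (CommRingCat.of k)).obj A) ⟶ opensPresheaf (specTop k))
    (hc : (toOpens (c.app _ ((schemePointsRepresentableBy A).homEquiv (𝟙 A))) :
      Set ((specTop k).obj A)) = Set.range j.left) :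
    Classifies (specTop k) ((schemePoints k).map j) c where
  injective B x y h := by
    have : Mono j := Over.mono_of_mono_left j
    exact ULift.ext _ _ ((cancel_mono j).1 (congrArg ULift.down h))
  mem_range_iff B x := by
    obtain ⟨f, rfl⟩ := (schemePointsRepresentableBy A).homEquiv.surjective x
    rw [(schemePointsRepresentableBy A).homEquiv_eq f, NatTrans.naturality_apply,
      toOpens_map_eq_top_iff, hc, ← (schemePointsRepresentableBy A).homEquiv_eq f]
    constructor
    · rintro ⟨y, hy⟩
      replace hy : y.down ≫ j = (algSpec (CommRingCat.of k)).map f := congrArg ULift.down hy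
      rintro _ ⟨p, rfl⟩
      exact ⟨y.down.left p, congr($(hy).left p)⟩
    · intro h
      let l := IsOpenImmersion.lift j.left ((algSpec (CommRingCat.of k)).map f).left h
      have hl : l ≫ j.left = ((algSpec (CommRingCat.of k)).map f).left :=
        IsOpenImmersion.lift_fac _ _ _
      refine ⟨⟨Over.homMk l ?_⟩, ULift.ext _ _ (Over.OverMorphism.ext hl)⟩
      rw [← Over.w j, reassoc_of% hl]
      exact Over.w ((algSpec (CommRingCat.of k)).map f)

lemma isOpenImmersionFpqc_iff {𝒰 𝒳 : FpqcSheaf k} (f : 𝒰 ⟶ 𝒳) :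
    IsOpenImmersionFpqc f ↔ ∃ c, Classifies (specTop k) f.hom c := by
  constructor
  · intro h
    refine exists_classifies_of_locally _ fun A x => ?_
    obtain ⟨q, hq⟩ := RepresentableBy.exists_app_eq (schemePointsRepresentableBy A) x
    obtain ⟨W, j, w, hj, sq⟩ := h A.unop q
    obtain ⟨c, hc⟩ := RepresentableBy.exists_app_eq (schemePointsRepresentableBy A)
      ((toOpens (Sp := specTop k) (X := op A)).symm j.left.opensRange)
    refine ⟨_, _, schemePointsRepresentableBy A, q, _, w, c, hq, sq,
      classifies_schemePoints_map j c ?_⟩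
    rw [hc]
    rfl
  · rintro ⟨c, h⟩ A x
    let V : ((algSpec (CommRingCat.of k)).obj (op A)).left.Opens :=
      toOpens ((x ≫ c).app _ ((schemePointsRepresentableBy (op A)).homEquiv (𝟙 (op A))))
    let j : Over.mk (V.ι ≫ ((algSpec (CommRingCat.of k)).obj (op A)).hom) ⟶
      (algSpec (CommRingCat.of k)).obj (op A) := Over.homMk V.ι
    have hj : IsOpenImmersion j.left := inferInstanceAs (IsOpenImmersion V.ι)
    obtain ⟨w, hw⟩ := h.exists_isPullback (classifies_schemePoints_map j (x ≫ c)
      V.range_ι.symm)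
    exact ⟨_, j, w, hj, hw⟩

end Fpqc

/-! ### The spectrum of locally constant functions -/

section StoneSpectrum

variable {k : Type u} [Field k] {S T : Type u} [TopologicalSpace S] [TopologicalSpace T]

variable (k) in
/-- The prime ideal of the locally constant functions that vanish at a point. -/
def stonePoint (s : S) : PrimeSpectrum (LocallyConstant S k) :=
  ⟨RingHom.ker (LocallyConstant.evalRingHom s : LocallyConstant S k →+* k), RingHom.ker_isPrime _⟩

lemma mem_stonePoint {s : S} {f : LocallyConstant S k} :
    f ∈ (stonePoint k s).asIdeal ↔ f s = 0 := Iff.rfl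

lemma stonePoint_injective [T2Space S] [CompactSpace S] [TotallyDisconnectedSpace S] :
    Function.Injective (stonePoint k : S → _) := by
  intro s t h
  by_contra hst
  obtain ⟨U, hU, hs, ht⟩ := exists_isClopen_of_totally_separated hst
  have h1 : LocallyConstant.charFn k hU ∈ (stonePoint k t).asIdeal := by
    rw [mem_stonePoint, LocallyConstant.charFn_eq_zero]
    exact ht
  rw [← h, mem_stonePoint, LocallyConstant.charFn_eq_zero] at h1
  exact h1 hs

lemma stonePoint_surjective [CompactSpace S] : Function.Surjective (stonePoint k : S → _) := by
  intro p
  obtain ⟨s, hs⟩ : ∃ s, p.asIdeal ≤ (stonePoint k s).asIdeal := by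
    by_contra! h
    simp only [SetLike.not_le_iff_exists, mem_stonePoint] at h
    choose f hf hfs using h
    obtain ⟨I, hI⟩ := isCompact_univ.elim_finite_subcover (fun s => {t | f s t ≠ 0})
      (fun s => (f s).isLocallyConstant {0}ᶜ)
      (fun s _ => Set.mem_iUnion.2 ⟨s, hfs s⟩)
    -- With the pointwise inverse, each factor is the indicator function of the zero set of `f s`.
    -- Those zero sets have empty intersection, so the product is `0`.
    have h0 : ∏ s ∈ I, (1 - (f s)⁻¹ * f s) ∈ p.asIdeal := by
      convert p.asIdeal.zero_mem
      ext t
      obtain ⟨s, hs, hst⟩ := Set.mem_iUnion₂.1 (hI (Set.mem_univ t))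
      change LocallyConstant.evalRingHom t _ = 0
      rw [map_prod]
      refine Finset.prod_eq_zero hs ?_
      change 1 - (f s t)⁻¹ * f s t = 0
      rw [inv_mul_cancel₀ hst, sub_self]
    obtain ⟨s, -, hs⟩ := p.2.prod_mem_iff.1 h0
    refine p.2.ne_top ((Ideal.eq_top_iff_one _).2 ?_)
    simpa using p.asIdeal.add_mem hs (p.asIdeal.mul_mem_left (f s)⁻¹ (hf s))
  refine ⟨s, (PrimeSpectrum.ext (le_antisymm hs fun f hf => ?_)).symm⟩
  -- The indicator function of this set kills `f` but does not vanish at `s`, so primality forces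
  -- `f` into `p`.
  have hU : IsClopen {t | f t = 0} := f.isLocallyConstant.isClopen_fiber 0
  have h0 : f * LocallyConstant.charFn k hU ∈ p.asIdeal := by
    convert p.asIdeal.zero_mem
    ext t
    by_cases ht : f t = 0 <;> simp [LocallyConstant.coe_charFn, ht]
  refine (p.2.mem_or_mem h0).resolve_right fun h1 => ?_
  have := hs h1
  rw [mem_stonePoint, LocallyConstant.charFn_eq_zero] at this
  exact this hf

variable (k S) in
/-- A profinite space is the prime spectrum of its ring of locally constant functions. -/
def stoneHomeo [T2Space S] [CompactSpace S] [TotallyDisconnectedSpace S] :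
    S ≃ₜ PrimeSpectrum (LocallyConstant S k) :=
  (Equiv.ofBijective _ ⟨stonePoint_injective, stonePoint_surjective⟩).toHomeomorphOfContinuousOpen
    (PrimeSpectrum.isTopologicalBasis_basic_opens.continuous_iff.2 <| by
      rintro _ ⟨f, rfl⟩
      exact f.isLocallyConstant {0}ᶜ)
    (by
      refine isTopologicalBasis_isClopen.isOpenMap_iff.2 fun U hU => ?_
      convert (PrimeSpectrum.basicOpen (LocallyConstant.charFn k hU)).isOpen
      ext p
      obtain ⟨s, rfl⟩ := stonePoint_surjective p
      refine (stonePoint_injective.mem_set_image).trans ?_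
      change s ∈ U ↔ ¬ (LocallyConstant.charFn k hU s = 0)
      rw [LocallyConstant.charFn_eq_zero, not_not])

/-- Extension by zero off a clopen subset is locally constant. -/
lemma comapₐ_surjective {m : C(T, S)} (hm : Topology.IsClosedEmbedding m)
    (ho : IsOpen (Set.range m)) : Function.Surjective (LocallyConstant.comapₐ (Z := k) k m) := by
  intro f
  have hm' : Topology.IsOpenEmbedding m := ⟨hm.isEmbedding, ho⟩
  refine ⟨⟨Function.extend m f 0, ?_⟩, ?_⟩
  · refine (IsLocallyConstant.iff_eventually_eq _).2 fun s => ?_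
    by_cases hs : s ∈ Set.range m
    · obtain ⟨t, rfl⟩ := hs
      rw [← hm'.map_nhds_eq, Filter.eventually_map]
      filter_upwards [f.isLocallyConstant.eventually_eq t] with t' ht'
      rw [hm.injective.extend_apply, hm.injective.extend_apply]
      exact ht'
    · filter_upwards [hm.isClosed_range.isOpen_compl.mem_nhds hs] with s' hs'
      rw [Function.extend_apply' _ _ _ hs, Function.extend_apply' _ _ _ hs']
      rfl
  · ext t
    exact hm.injective.extend_apply _ _ _

lemma exists_comp_comapₐ_eq {A : Type*} [CommRing A] [Algebra k A] {m : C(T, S)}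
    (hm : Topology.IsClosedEmbedding m) (ho : IsOpen (Set.range m))
    (φ : LocallyConstant S k →ₐ[k] A)
    (hφ : φ (LocallyConstant.charFn k ⟨hm.isClosed_range, ho⟩) = 1) :
    ∃ ψ : LocallyConstant T k →ₐ[k] A, ψ.comp (LocallyConstant.comapₐ k m) = φ := by
  refine ⟨AlgHom.liftOfSurjective _ (comapₐ_surjective hm ho) φ fun f hf => ?_,
    AlgHom.liftOfSurjective_comp _ _ _ _⟩
  have h0 : f * LocallyConstant.charFn k ⟨hm.isClosed_range, ho⟩ = 0 := by
    ext s
    by_cases hs : s ∈ Set.range m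
    · obtain ⟨t, rfl⟩ := hs
      have : f (m t) = 0 := congr($(hf) t)
      simp [this]
    · exact mul_eq_zero_of_right _ ((LocallyConstant.charFn_eq_zero k _ _).2 hs)
  change φ f = 0
  rw [← mul_one (φ f), ← hφ, ← map_mul, h0, map_zero]

/-- The image is an idempotent lying in no maximal ideal, hence a unit, hence `1`. -/
lemma map_charFn_eq_one {A : Type*} [CommRing A] [Algebra k A] [CompactSpace S]
    (φ : LocallyConstant S k →ₐ[k] A) {U : Set S} (hU : IsClopen U)
    (h : Set.range (PrimeSpectrum.comap φ.toRingHom) ⊆ stonePoint k '' U) :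
    φ (LocallyConstant.charFn k hU) = 1 := by
  have he : IsIdempotentElem (φ (LocallyConstant.charFn k hU)) := by
    rw [IsIdempotentElem, ← map_mul]
    congr 1
    ext s
    by_cases hs : s ∈ U <;> simp [LocallyConstant.coe_charFn, hs]
  refine (IsIdempotentElem.iff_eq_one_of_isUnit ?_).1 he
  by_contra hu
  obtain ⟨p, hp, hmem⟩ := exists_max_ideal_of_mem_nonunits hu
  obtain ⟨s, hs, hsp⟩ := h ⟨⟨p, hp.isPrime⟩, rfl⟩
  have : LocallyConstant.charFn k hU ∈ (stonePoint k s).asIdeal := by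
    rw [hsp]
    exact hmem
  rw [mem_stonePoint, LocallyConstant.charFn_eq_zero] at this
  exact this hs

end StoneSpectrum

/-! ### Profinite sets as affine schemes, and condensed open embeddings -/

section Profinite

variable (k : Type u) [Field k]

/-- The spectrum of the ring of locally constant functions on a profinite set. -/
abbrev stoneTop : Profinite.{u} ⥤ TopCat.{u} := stoneFunctor k ⋙ specTop k

variable {k}

variable (k) in
/-- A profinite set is the spectrum of its ring of locally constant functions. -/
def stoneEquiv (S : Profinite.{u}) : S ≃ₜ (stoneTop k).obj S := stoneHomeo k S

lemma stoneTop_map_stoneEquiv {S T : Profinite.{u}} (g : T ⟶ S) (t : T) :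
    (stoneTop k).map g (stoneEquiv k T t) = stoneEquiv k S (g t) := rfl

lemma range_stoneTop_map {S T : Profinite.{u}} (g : T ⟶ S) :
    Set.range ((stoneTop k).map g) = stoneEquiv k S '' Set.range g := by
  rw [← Set.range_comp, ← (stoneEquiv k T).surjective.range_comp ((stoneTop k).map g)]
  rfl

instance : EnoughPoints (stoneTop k) where
  exists_range_eq S p := by
    obtain ⟨s, rfl⟩ := (stoneEquiv k S).surjective p
    refine ⟨Profinite.of PUnit, CompHausLike.ofHom _ (ContinuousMap.const PUnit s), ?_⟩
    rw [range_stoneTop_map]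
    have : Set.range (CompHausLike.ofHom (X := Profinite.of PUnit) (Y := S) _
        (ContinuousMap.const PUnit s)) = {s} := Set.range_const
    rw [this]
    exact Set.image_singleton

lemma exists_mem_range_of_mem_coherentTopology (X : Profinite.{u}) (S : Sieve X)
    (hS : S ∈ coherentTopology Profinite.{u} X) (p : (stoneTop k).obj X) :
    ∃ (Y : Profinite.{u}) (f : Y ⟶ X), S f ∧ p ∈ Set.range ((stoneTop k).map f) := by
  obtain ⟨s, rfl⟩ := (stoneEquiv k X).surjective p
  obtain ⟨α, _, Y, π, h, hπ⟩ := (coherentTopology.mem_sieves_iff_hasEffectiveEpiFamily S).1 hS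
  have hs := (Profinite.effectiveEpiFamily_tfae Y π).out 0 2
  obtain ⟨a, y, rfl⟩ := hs.1 h s
  refine ⟨Y a, π a, hπ a, ?_⟩
  rw [range_stoneTop_map]
  exact ⟨_, ⟨y, rfl⟩, rfl⟩

/-- The inclusions of clopen subsets of profinite sets. -/
def clopenImmersions : MorphismProperty Profinite.{u} :=
  fun _ _ m => Function.Injective m ∧ IsOpen (Set.range m)

lemma exists_comp_stoneFunctor_map_eq {Y : (CommAlgCat.{u} k)ᵒᵖ} {S T : Profinite.{u}} {m : T ⟶ S}
    (hm : clopenImmersions m) (φ : Y ⟶ (stoneFunctor k).obj S)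
    (h : Set.range ((specTop k).map φ) ⊆ stoneEquiv k S '' Set.range m) :
    ∃ ψ : Y ⟶ (stoneFunctor k).obj T, ψ ≫ (stoneFunctor k).map m = φ := by
  have hm' : Topology.IsClosedEmbedding m.hom.hom :=
    m.hom.hom.continuous.isClosedEmbedding hm.1
  obtain ⟨ψ, hψ⟩ := exists_comp_comapₐ_eq hm' hm.2 φ.unop.hom (map_charFn_eq_one _ _ h)
  refine ⟨(CommAlgCat.ofHom ψ).op, Quiver.Hom.unop_inj (CommAlgCat.hom_ext hψ)⟩

lemma mono_stoneFunctor_map {S T : Profinite.{u}} {m : T ⟶ S} (hm : clopenImmersions m) :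
    Mono ((stoneFunctor k).map m) := by
  have hm' : Topology.IsClosedEmbedding m.hom.hom :=
    m.hom.hom.continuous.isClosedEmbedding hm.1
  refine ⟨fun a b h => Quiver.Hom.unop_inj (CommAlgCat.hom_ext (AlgHom.ext fun x => ?_))⟩
  obtain ⟨y, rfl⟩ := comapₐ_surjective (k := k) hm' hm.2 x
  exact congr(($h).unop.hom y)

/-- The inclusion of a clopen subset of a profinite set. -/
lemma exists_clopenImmersions {S : Profinite.{u}} {U : Set S} (hU : IsClopen U) :
    ∃ (K : Profinite.{u}) (m : K ⟶ S), clopenImmersions m ∧ Set.range m = U := by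
  have : CompactSpace U := isCompact_iff_compactSpace.1 hU.isClosed.isCompact
  have h : Set.range (CompHausLike.ofHom (X := Profinite.of U) (Y := S) _
      ⟨Subtype.val, continuous_subtype_val⟩) = U := Subtype.range_val
  refine ⟨Profinite.of U, CompHausLike.ofHom _ ⟨Subtype.val, continuous_subtype_val⟩,
    ⟨Subtype.val_injective, ?_⟩, h⟩
  rw [h]
  exact hU.isOpen

lemma refines_clopenImmersions : Refines (stoneFunctor k) (specTop k) clopenImmersions where
  exists_fac {Y S} φ W h := by
    have hc : IsClosed (stoneEquiv k S ⁻¹' Set.range ((specTop k).map φ)) := by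
      have : CompactSpace ((specTop k).obj Y) :=
        inferInstanceAs (CompactSpace (PrimeSpectrum Y.unop))
      refine IsCompact.isClosed ?_
      rw [(stoneEquiv k S).isCompact_preimage]
      exact isCompact_range ((specTop k).map φ).hom.continuous
    -- The image of `φ` is compact, so a clopen subset fits between it and `W`.
    obtain ⟨C, hC, hZ, hW⟩ := exists_clopen_of_closed_subset_open hc
      (W.isOpen.preimage (stoneEquiv k S).continuous) (Set.preimage_mono h)
    obtain ⟨K, m, hm, rfl⟩ := exists_clopenImmersions hC
    obtain ⟨ψ, hψ⟩ := exists_comp_stoneFunctor_map_eq hm φ (by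
      rintro p hp
      obtain ⟨s, rfl⟩ := (stoneEquiv k S).surjective p
      exact ⟨s, hZ hp, rfl⟩)
    refine ⟨K, m, ψ, hm, ?_, hψ⟩
    refine (range_stoneTop_map (k := k) m).trans_subset ?_
    rintro _ ⟨s, hs, rfl⟩
    exact hW hs
  exists_lift {Y S K T} m n hm ψ φ h := by
    -- This clopen subset is the fibre product of `m` and `n`; it contains the image of `φ` because
    -- `φ` agrees with `ψ` over `S`.
    have hU : IsClopen (n ⁻¹' Set.range m) :=
      IsClopen.preimage ⟨(isCompact_range m.hom.hom.continuous).isClosed, hm.2⟩ n.hom.hom.continuous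
    obtain ⟨L, q, hq, hqr⟩ := exists_clopenImmersions hU
    have hm' : Topology.IsClosedEmbedding m.hom.hom :=
      m.hom.hom.continuous.isClosedEmbedding hm.1
    have hr (x : L) : ∃ y, m y = n (q x) := by
      have : q x ∈ n ⁻¹' Set.range m := by
        rw [← hqr]
        exact ⟨x, rfl⟩
      exact this
    choose p hp using hr
    have hpc : Continuous p := by
      rw [hm'.continuous_iff]
      convert (q ≫ n).hom.hom.continuous
      ext x
      exact hp x
    let p' : L ⟶ K := CompHausLike.ofHom _ ⟨p, hpc⟩
    have hpq : p' ≫ m = q ≫ n := by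
      ext x
      exact hp x
    obtain ⟨χ, hχ⟩ := exists_comp_stoneFunctor_map_eq hq φ (by
      rintro _ ⟨y, rfl⟩
      obtain ⟨t, ht⟩ := (stoneEquiv k T).surjective ((specTop k).map φ y)
      refine ⟨t, ?_, ht⟩
      rw [hqr]
      obtain ⟨s, hs⟩ := (stoneEquiv k K).surjective ((specTop k).map ψ y)
      refine ⟨s, (stoneEquiv k S).injective ?_⟩
      rw [← stoneTop_map_stoneEquiv, ← stoneTop_map_stoneEquiv, hs, ht]
      exact congr((specTop k).map $h y))
    have := mono_stoneFunctor_map (k := k) hm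
    refine ⟨L, p', q, χ, hpq, ?_, hχ⟩
    rw [← cancel_mono ((stoneFunctor k).map m), Category.assoc, ← Functor.map_comp, hpq,
      Functor.map_comp, reassoc_of% hχ, h]

/-- A profinite set represents the condensed set that it defines. -/
def ofProfiniteRepresentableBy (S : Profinite.{u}) : (ofProfinite S).obj.RepresentableBy S where
  homEquiv {T} :=
    { toFun g := (⟨fun t => ⟨g t⟩, continuous_uliftUp.comp g.hom.hom.continuous⟩ :
        C(T, ULift.{u + 1} S))
      invFun y := CompHausLike.ofHom _ ⟨fun t => ((show C(T, ULift.{u + 1} S) from y) t).down,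
        continuous_uliftDown.comp (show C(T, ULift.{u + 1} S) from y).continuous⟩
      left_inv _ := rfl
      right_inv _ := rfl }
  homEquiv_comp _ _ := rfl

lemma classifies_topToCond_map {S : Profinite.{u}} {V : TopCat.{u}}
    (i : V ⟶ Profinite.toTopCat.obj S) (hi : Topology.IsOpenEmbedding i)
    (c : (ofProfinite S).obj ⟶ opensPresheaf (stoneTop k))
    (hc : (toOpens (c.app _ ((ofProfiniteRepresentableBy S).homEquiv (𝟙 S))) :
      Set ((stoneTop k).obj S)) = stoneEquiv k S '' Set.range i) :
    Classifies (stoneTop k) (topToCond.map i).hom c where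
  injective T x y h := by
    refine ContinuousMap.ext fun t => ULift.ext _ _ (hi.injective ?_)
    exact congrArg ULift.down (DFunLike.congr_fun (F := C(T.unop, ULift.{u + 1} S)) h t)
  mem_range_iff T x := by
    obtain ⟨g, rfl⟩ := (ofProfiniteRepresentableBy S).homEquiv.surjective x
    rw [(ofProfiniteRepresentableBy S).homEquiv_eq g, NatTrans.naturality_apply,
      toOpens_map_eq_top_iff, hc, ← (ofProfiniteRepresentableBy S).homEquiv_eq g]
    change _ ↔ Set.range ((stoneTop k).map g) ⊆ _
    rw [range_stoneTop_map, Set.image_subset_image_iff (stoneEquiv k S).injective]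
    constructor
    · rintro ⟨y, hy⟩
      rintro _ ⟨t, rfl⟩
      exact ⟨((show C(T.unop, ULift.{u + 1} V) from y) t).down,
        congrArg ULift.down (DFunLike.congr_fun (F := C(T.unop, ULift.{u + 1} S)) hy t)⟩
    · intro h
      choose y hy using fun t => h ⟨t, rfl⟩
      have hyc : Continuous y := by
        rw [hi.isEmbedding.continuous_iff]
        have e : (i ∘ y : T.unop → S) = g := funext hy
        exact e ▸ g.hom.hom.continuous
      refine ⟨(⟨fun t => ⟨y t⟩, continuous_uliftUp.comp hyc⟩ : C(T.unop, ULift.{u + 1} V)), ?_⟩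
      exact ContinuousMap.ext fun t => ULift.ext _ _ (hy t)

variable (k) in
lemma isOpenEmbeddingCond_iff {U X : CondSet.{u}} (f : U ⟶ X) :
    IsOpenEmbeddingCond f ↔ ∃ c, Classifies (stoneTop k) f.hom c := by
  constructor
  · intro h
    refine exists_classifies_of_locally _ fun S x => ?_
    obtain ⟨q, hq⟩ := RepresentableBy.exists_app_eq (ofProfiniteRepresentableBy S) x
    obtain ⟨V, i, v, hi, sq⟩ := h S ⟨q⟩
    obtain ⟨c, hc⟩ := RepresentableBy.exists_app_eq (ofProfiniteRepresentableBy S)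
      ((toOpens (Sp := stoneTop k) (X := op S)).symm
        ⟨stoneEquiv k S '' Set.range i, (stoneEquiv k S).isOpenMap _ hi.isOpen_range⟩)
    refine ⟨_, _, ofProfiniteRepresentableBy S, q, _, v.hom, c, hq,
      sq.map (sheafToPresheaf _ _), classifies_topToCond_map i hi c ?_⟩
    rw [hc]
    rfl
  · rintro ⟨c, h⟩ S s
    let W : TopologicalSpace.Opens ((stoneTop k).obj S) :=
      toOpens ((s.hom ≫ c).app _ ((ofProfiniteRepresentableBy S).homEquiv (𝟙 S)))
    let V : TopologicalSpace.Opens S :=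
      ⟨stoneEquiv k S ⁻¹' W, W.isOpen.preimage (stoneEquiv k S).continuous⟩
    let i : TopCat.of V ⟶ Profinite.toTopCat.obj S :=
      TopCat.ofHom ⟨Subtype.val, continuous_subtype_val⟩
    have hi : Topology.IsOpenEmbedding i := V.isOpen.isOpenEmbedding_subtypeVal
    have hr : Set.range i = stoneEquiv k S ⁻¹' W := Subtype.range_val
    obtain ⟨v, hv⟩ := h.exists_isPullback (classifies_topToCond_map i hi (s.hom ≫ c)
      ((Set.image_preimage_eq (W : Set _) (stoneEquiv k S).surjective).symm.trans
        (congrArg (fun A => stoneEquiv k S '' A) hr.symm)))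
    exact ⟨TopCat.of V, i, ⟨v⟩, hi, IsPullback.of_map (sheafToPresheaf _ _) (Sheaf.hom_ext hv.w) hv⟩

end Profinite

/-! ### Comparison of classifying maps -/

section Petra

variable (k : Type u) [Field k]

/-- Open subsets of `X` correspond to open subsets of its pétra space. -/
lemma exists_petra_equiv (X : CondSet.{u}) :
    ∃ e : (X.obj ⟶ opensPresheaf (stoneTop k)) ≃
        (((petra k).obj X).obj ⟶ opensPresheaf (specTop k)),
      ∀ (U : CondSet.{u}) (f : U ⟶ X) (c : X.obj ⟶ opensPresheaf (stoneTop k)),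
        Classifies (stoneTop k) f.hom c → Classifies (specTop k) ((petra k).map f).hom (e c) := by
  obtain ⟨e, he⟩ := exists_lan_equiv (F := stoneFunctor k) X.obj (specTop k)
  let L := (stoneFunctor k).op.lan.obj X.obj
  let e' : (L ⟶ opensPresheaf (specTop k)) ≃
      (sheafify (fpqcTopology k) L ⟶ opensPresheaf (specTop k)) :=
    { toFun c := sheafifyLift _ c isSheaf_opensPresheaf
      invFun c := toSheafify _ L ≫ c
      left_inv c := toSheafify_sheafifyLift _ c isSheaf_opensPresheaf
      right_inv c := (sheafifyLift_unique _ _ isSheaf_opensPresheaf c rfl).symm }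
  refine ⟨e.trans e', fun U f c hc => ?_⟩
  refine Classifies.presheafToSheaf_map _ exists_mem_range_of_mem_fpqcTopology ?_
  have h : toSheafify _ L ≫ e' (e c) = e c := e'.symm_apply_apply _
  exact h.symm ▸ hc.lan_map refines_clopenImmersions (he c)

end Petra

end

end StoneDuality

/-- The correspondence holds for every condensed set: quasi-separatedness is not needed. -/
theorem mainTheorem6 (k : Type u) [Field k] (X : StoneDuality.CondSet.{u})
    (hX : StoneDuality.IsQuasiSeparated X) :
    ∃ φ : StoneDuality.IsoClasses (StoneDuality.openEmbeddings X) ≃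
        StoneDuality.IsoClasses (StoneDuality.openImmersions ((StoneDuality.petra k).obj X)),
      ∀ U : (StoneDuality.openEmbeddings X).FullSubcategory,
        ∃ h : StoneDuality.openImmersions ((StoneDuality.petra k).obj X)
            ((Over.post (StoneDuality.petra k)).obj U.obj),
          φ (Quotient.mk _ U) =
            Quotient.mk _ ⟨(Over.post (StoneDuality.petra k)).obj U.obj, h⟩ := by
  obtain ⟨e, he⟩ := StoneDuality.exists_isoClasses_equiv
    (StoneDuality.exists_mem_range_of_mem_coherentTopology (k := k)) X
    (StoneDuality.openEmbeddings X) fun U => StoneDuality.isOpenEmbeddingCond_iff k U.hom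
  obtain ⟨e', he'⟩ := StoneDuality.exists_isoClasses_equiv
    (StoneDuality.exists_mem_range_of_mem_fpqcTopology (k := k)) ((StoneDuality.petra k).obj X)
    (StoneDuality.openImmersions _) fun U => StoneDuality.isOpenImmersionFpqc_iff U.hom
  obtain ⟨p, hp⟩ := StoneDuality.exists_petra_equiv k X
  refine ⟨(e.trans p).trans e'.symm, fun U => ?_⟩
  have hU := hp _ _ _ (he U)
  have h : StoneDuality.openImmersions ((StoneDuality.petra k).obj X)
      ((Over.post (StoneDuality.petra k)).obj U.obj) :=
    (StoneDuality.isOpenImmersionFpqc_iff _).2 ⟨_, hU⟩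
  refine ⟨h, ?_⟩
  rw [Equiv.trans_apply, Equiv.trans_apply, Equiv.symm_apply_eq]
  -- Both classes have the same classifying map.
  exact hU.unique (he' ⟨_, h⟩)
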